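/- Let $k\ge 2$ and let $T=(V(T),E(T))$ be a $k$-uniform hypertree, i.e. a finite connected hypergraph with at least one vertex, all of whose edges are sets of exactly $k$ vertices, and which contains no cycle (a cycle being a cyclic sequence $v_0,e_0,v_1,e_1,\dots,v_{n-1},e_{n-1},v_n=v_0$ with $n\ge 2$, distinct vertices $v_0,\dots,v_{n-1}$ and distinct edges $e_0,\dots,e_{n-1}$ such that $v_i,v_{i+1}\in e_i$ for all $0\le i\le n-1$). Let $d_T(v)$ be the number of edges of $T$ containing $v$. For a sub-hypergraph $\widetilde T$ of $T$, the Laplacian matching polynomial of $\widetilde T$ with respect to $T$ is $$\varphi_T(\widetilde T)=\sum_{M\in\mathcal M(\widetilde T)}(-1)^{(k-1)|M|}\prod_{v\in V(\widetilde T)\setminus V(M)}(\lambda-d_T(v))\in\mathbb C[\lambda],$$ where $\mathcal M(\widetilde T)$ is the set of matchings of $\widetilde T$ (sets of pairwise disjoint edges of $\widetilde T$, including the empty set) and $V(M)$ is the union of the edges in $M$. Then zero is a simple root of $\varphi_T(T)$. Moreover, zero is not a root of $\varphi_T(\widetilde T)$ for any sub-hypertree $\widetilde T$ of $T$ with $\widetilde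 T\ne T$, i.e. for any sub-hypergraph $\widetilde T\neq T$ of $T$ that is itself a $k$-uniform hypertree (single vertices without edges included). -/

import Mathlib

open Polynomial

namespace Hypergraph

variable {α : Type*}

/-- `H` is `k`-uniform: every edge has exactly `k` vertices. -/
def IsUniform (H : Hypergraph α) (k : ℕ) : Prop :=
  ∀ e ∈ H.edgeSet, e.encard = k

/-- `H` is connected: it has a vertex, and any two vertices are joined by a finite chain of
vertices in which consecutive ones lie in a common edge. -/
def IsConnected (H : Hypergraph α) : Prop :=
  H.vertexSet.Nonempty ∧
    ∀ u ∈ H.vertexSet, ∀ v ∈ H.vertexSet, Relation.ReflTransGen H.Adj u v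

/-- `H` is acyclic (in the sense of Berge): there is no cycle `v₀ e₀ v₁ e₁ … vₙ₋₁ eₙ₋₁ v₀` with
`n ≥ 2`, distinct vertices `vᵢ` and distinct edges `eᵢ` such that `vᵢ, vᵢ₊₁ ∈ eᵢ` for all `i`
(indices modulo `n`). -/
def IsBergeAcyclic (H : Hypergraph α) : Prop :=
  ¬ ∃ (n : ℕ) (v : ZMod n → α) (e : ZMod n → Set α),
      2 ≤ n ∧ Function.Injective v ∧ Function.Injective e ∧
        ∀ i, e i ∈ H.edgeSet ∧ v i ∈ e i ∧ v (i + 1) ∈ e i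

/-- A `k`-uniform hypertree: a connected, acyclic, `k`-uniform hypergraph. -/
structure IsHypertree (H : Hypergraph α) (k : ℕ) : Prop where
  uniform : H.IsUniform k
  connected : H.IsConnected
  acyclic : H.IsBergeAcyclic

/-- `S` is a sub-hypergraph of `H`: its vertices and edges are vertices and edges of `H`. -/
def IsSubhypergraph (S H : Hypergraph α) : Prop :=
  S.vertexSet ⊆ H.vertexSet ∧ S.edgeSet ⊆ H.edgeSet

/-- The degree of `v` in `H`: the number of edges of `H` containing `v`. -/
noncomputable def degree (H : Hypergraph α) (v : α) : ℕ :=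
  {e ∈ H.edgeSet | v ∈ e}.ncard

/-- The set of matchings of `H`: the sets of pairwise disjoint edges of `H`
(including the empty set). -/
def matchings (H : Hypergraph α) : Set (Set (Set α)) :=
  {M | M ⊆ H.edgeSet ∧ M.PairwiseDisjoint id}

/-- The Laplacian matching polynomial `φ_H(S)` of a sub-hypergraph `S` with respect to a
`k`-uniform hypergraph `H` (with finite vertex set),
`∑_M (-1) ^ ((k - 1) |M|) ∏_{v ∈ V(S) \ V(M)} (λ - d_H(v))`, where `M` runs over the matchings of
`S`, the set `V(M)` is the union of the edges in `M`, and the degrees are taken in `H`. -/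
noncomputable def laplacianMatchingPoly (k : ℕ) (H S : Hypergraph α) : ℂ[X] :=
  ∑ᶠ M ∈ S.matchings, (-1) ^ ((k - 1) * M.ncard) *
    ∏ᶠ v ∈ S.vertexSet \ ⋃₀ M, (X - C (H.degree v : ℂ))

end Hypergraph

/-!
Pull a sign `-1` out of every factor `λ - d(v)`: up to sign, the Laplacian matching polynomial at
`λ = -y` is the sum over the matchings `M` of `(-1) ^ |M|` times the product of the weights
`w v = d(v) + y` of the uncovered vertices. If all vertices of an edge `e` except possibly `r` lie
in no other edge, then splitting the matchings by whether they contain `e` shows that this sum is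
`P` times the same sum for the hypergraph with `e \ {r}` removed and with `w r` replaced by
`w r - 1 / P`, where `P` is the product of the weights on `e \ {r}`
(`Hypergraph.IsPendant.matchingSum_neg_eq`).

Every hypertree is reduced to a single vertex by such removals
(`Hypergraph.IsHypertree.induction`), and a removal lowers the degree of `r` by exactly one. So if
the weights are the degrees, then `P = 1`, the weights stay the degrees, and the sum equals the
degree `0` of the last vertex (`Hypergraph.IsHypertree.matchingSum_degree_eq_zero`). If the weights
are at least the degrees, then `P ≥ 1` and this stays so; moreover an excess `ε` of some weight over
the degree is never lost, and the sum is at least `ε` in absolute value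
(`Hypergraph.IsHypertree.le_abs_matchingSum`).

Hence `φ_T(T)` vanishes at zero, while `|φ_T(T)(-y)| ≥ y` for `y ≥ 0` excludes a double root. A
proper sub-hypertree `S` has a vertex whose degree in `T` is larger than that in `S`, so that
`|φ_T(S)(0)| ≥ 1`.
-/

namespace Hypergraph

variable {α : Type*}

/-! ### Pendant edges -/

/-- The sub-hypergraph of `H` induced on the vertices outside `U`: its edges are the edges of `H`
disjoint from `U`. -/
def deleteVertices (H : Hypergraph α) (U : Set α) : Hypergraph α where
  vertexSet := H.vertexSet \ U
  edgeSet := {f ∈ H.edgeSet | Disjoint f U}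
  subset_vertexSet_of_mem_edgeSet' _ hf :=
    Set.subset_sdiff.2 ⟨H.subset_vertexSet_of_mem_edgeSet' hf.1, hf.2⟩

/-- The edge `e` of `H` is pendant at its vertex `r`: every vertex of `e` other than `r` lies in
no other edge. All vertices of `e` are allowed to have degree one. -/
structure IsPendant (H : Hypergraph α) (e : Set α) (r : α) : Prop where
  mem_edgeSet : e ∈ H.edgeSet
  mem : r ∈ e
  nontrivial : e.Nontrivial
  eq_of_mem : ∀ u ∈ e, u ≠ r → ∀ f ∈ H.edgeSet, u ∈ f → f = e

theorem finite_edgeSet {H : Hypergraph α} (hV : H.vertexSet.Finite) : H.edgeSet.Finite :=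
  hV.finite_subsets.subset fun _ he ↦ H.subset_vertexSet_of_mem_edgeSet' he

theorem IsUniform.nontrivial {H : Hypergraph α} {k : ℕ} (hH : H.IsUniform k) (hk : 2 ≤ k)
    {e : Set α} (he : e ∈ H.edgeSet) : e.Nontrivial := by
  rw [← Set.one_lt_encard_iff_nontrivial, hH e he]
  exact_mod_cast hk

/-- A stretch of a walk that closes up, and repeats neither vertices nor edges, is a cycle. -/
theorem IsBergeAcyclic.not_closed_walk {H : Hypergraph α} (hH : H.IsBergeAcyclic)
    (v : ℕ → α) (e : ℕ → Set α) (he : ∀ i, e i ∈ H.edgeSet) (hv : ∀ i, v i ∈ e i)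
    (hv' : ∀ i, v (i + 1) ∈ e i) {a n : ℕ} (hn : 2 ≤ n)
    (hvinj : ∀ i j, i < j → j < n → v (a + i) ≠ v (a + j))
    (heinj : ∀ i j, i < j → j < n → e (a + i) ≠ e (a + j))
    (hclose : v a ∈ e (a + (n - 1))) : False := by
  have : NeZero n := ⟨by omega⟩
  have inj : ∀ {β : Type _} (g : ℕ → β), (∀ i j, i < j → j < n → g (a + i) ≠ g (a + j)) →
      Function.Injective fun i : ZMod n ↦ g (a + i.val) := by
    intro β g hg i j hij
    apply ZMod.val_injective n
    rcases lt_trichotomy i.val j.val with h | h | h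
    · exact (hg _ _ h j.val_lt hij).elim
    · exact h
    · exact (hg _ _ h i.val_lt hij.symm).elim
  refine hH ⟨n, fun i ↦ v (a + i.val), fun i ↦ e (a + i.val), hn, inj v hvinj, inj e heinj,
    fun i ↦ ⟨he _, hv _, ?_⟩⟩
  have : Fact (1 < n) := ⟨hn⟩
  by_cases hi : i.val + 1 < n
  · have h : (i + 1).val = i.val + 1 := by
      rw [ZMod.val_add_of_lt] <;> rw [ZMod.val_one]
      exact hi
    simpa [h, ← add_assoc] using hv' (a + i.val)
  · have hi' : i.val = n - 1 := by have := i.val_lt; omega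
    have h : (i + 1).val = 0 := by
      rw [ZMod.val_add, ZMod.val_one, hi', Nat.sub_add_cancel (by omega), Nat.mod_self]
    simpa [h, hi'] using hclose

/-- If no edge were pendant, then one could walk forever, always leaving an edge through a vertex
different from the one of entry into a different edge; a repetition with the smallest possible gap
would then be a cycle. -/
theorem exists_isPendant {H : Hypergraph α} {k : ℕ} (hk : 2 ≤ k) (hV : H.vertexSet.Finite)
    (hu : H.IsUniform k) (hH : H.IsBergeAcyclic) (hE : H.edgeSet.Nonempty) :
    ∃ e r, H.IsPendant e r := by
  by_contra! hno
  have step : ∀ p : {p : α × Set α // p.1 ∈ p.2 ∧ p.2 ∈ H.edgeSet},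
      ∃ q : {p : α × Set α // p.1 ∈ p.2 ∧ p.2 ∈ H.edgeSet},
        q.1.1 ∈ p.1.2 ∧ q.1.1 ≠ p.1.1 ∧ q.1.2 ≠ p.1.2 := by
    rintro ⟨⟨r, e⟩, hr, he⟩
    by_contra! hq
    exact hno e r ⟨he, hr, hu.nontrivial hk he,
      fun u hue hur f hf huf ↦ hq ⟨⟨u, f⟩, huf, hf⟩ hue hur⟩
  choose next hnext using step
  obtain ⟨e₀, he₀⟩ := hE
  obtain ⟨v₀, hv₀⟩ := (hu.nontrivial hk he₀).nonempty
  let p : ℕ → {p : α × Set α // p.1 ∈ p.2 ∧ p.2 ∈ H.edgeSet} :=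
    fun n ↦ Nat.rec ⟨⟨v₀, e₀⟩, hv₀, he₀⟩ (fun _ q ↦ next q) n
  have hp : ∀ n, p (n + 1) = next (p n) := fun _ ↦ rfl
  let v : ℕ → α := fun n ↦ (p n).1.1
  let e : ℕ → Set α := fun n ↦ (p n).1.2
  have he : ∀ i, e i ∈ H.edgeSet := fun i ↦ (p i).2.2
  have hv : ∀ i, v i ∈ e i := fun i ↦ (p i).2.1
  have hv' : ∀ i, v (i + 1) ∈ e i := fun i ↦ by simp only [v, e, hp]; exact (hnext _).1
  have hvne : ∀ i, v (i + 1) ≠ v i := fun i ↦ by simp only [v, hp]; exact (hnext _).2.1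
  have hene : ∀ i, e (i + 1) ≠ e i := fun i ↦ by simp only [e, hp]; exact (hnext _).2.2
  have hrep : ∃ n, 0 < n ∧ ∃ i, v i = v (i + n) ∨ e i = e (i + n) := by
    have : Finite H.edgeSet := finite_edgeSet hV
    obtain ⟨i, j, hij, h⟩ :=
      Finite.exists_ne_map_eq_of_infinite fun i ↦ (⟨e i, he i⟩ : H.edgeSet)
    have h : e i = e j := congrArg Subtype.val h
    rcases lt_or_gt_of_ne hij with hlt | hlt
    · exact ⟨j - i, by omega, i, .inr (by rwa [Nat.add_sub_cancel' hlt.le])⟩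
    · exact ⟨i - j, by omega, j, .inr (by rw [Nat.add_sub_cancel' hlt.le]; exact h.symm)⟩
  classical
  obtain ⟨hpos, i, hi⟩ := Nat.find_spec hrep
  have hmin : ∀ m, 0 < m → m < Nat.find hrep → ∀ i, v i ≠ v (i + m) ∧ e i ≠ e (i + m) := by
    intro m hm hlt i
    have := Nat.find_min hrep hlt
    grind
  set n := Nat.find hrep
  have hn : 2 ≤ n := by
    by_contra hn
    have : n = 1 := by omega
    rw [this] at hi
    exact hi.elim (fun h ↦ hvne i h.symm) fun h ↦ hene i h.symm
  have hvinj : ∀ a i j, i < j → j < n → v (a + i) ≠ v (a + j) := fun a i j hij hj ↦ by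
    have := (hmin (j - i) (by omega) (by omega) (a + i)).1
    rwa [show a + i + (j - i) = a + j by omega] at this
  have heinj : ∀ a i j, i < j → j < n → e (a + i) ≠ e (a + j) := fun a i j hij hj ↦ by
    have := (hmin (j - i) (by omega) (by omega) (a + i)).2
    rwa [show a + i + (j - i) = a + j by omega] at this
  rcases hi with h | h
  · refine hH.not_closed_walk v e he hv hv' hn (hvinj i) (heinj i) ?_
    have := hv' (i + (n - 1))
    rwa [show i + (n - 1) + 1 = i + n by omega, ← h] at this
  · refine hH.not_closed_walk v e he hv hv' hn (hvinj (i + 1)) (heinj (i + 1)) ?_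
    rw [show i + 1 + (n - 1) = i + n by omega, ← h]
    exact hv' i

namespace IsPendant

variable {H : Hypergraph α} {e : Set α} {r : α}

theorem edgeSet_deleteVertices (h : H.IsPendant e r) :
    (H.deleteVertices (e \ {r})).edgeSet = H.edgeSet \ {e} := by
  ext f
  refine and_congr_right fun hf ↦ ⟨?_, fun hfe ↦ Set.disjoint_left.2 fun u huf hu ↦
    hfe (h.eq_of_mem u hu.1 hu.2 f hf huf)⟩
  rintro hd rfl
  obtain ⟨u, hu, hur⟩ := h.nontrivial.exists_ne r
  exact Set.disjoint_left.1 hd hu ⟨hu, hur⟩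

theorem mem_vertexSet_deleteVertices (h : H.IsPendant e r) :
    r ∈ (H.deleteVertices (e \ {r})).vertexSet :=
  ⟨H.subset_vertexSet_of_mem_edgeSet' h.mem_edgeSet h.mem, fun hr ↦ hr.2 rfl⟩

theorem isHypertree_deleteVertices {k : ℕ} (h : H.IsPendant e r) (hH : H.IsHypertree k) :
    (H.deleteVertices (e \ {r})).IsHypertree k := by
  refine ⟨fun f hf ↦ hH.uniform f hf.1, ⟨⟨r, h.mem_vertexSet_deleteVertices⟩, ?_⟩, ?_⟩
  · -- Collapsing `e` to `r` maps a chain in `H` to a chain avoiding `e \ {r}`.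
    classical
    let c : α → α := fun x ↦ if x ∈ e then r else x
    have hc : ∀ x ∈ (H.deleteVertices (e \ {r})).vertexSet, c x = x := by
      intro x hx
      by_cases hxe : x ∈ e
      · have : x = r := by by_contra hxr; exact hx.2 ⟨hxe, hxr⟩
        simp [c, this]
      · simp [c, hxe]
    have key : ∀ u v, Relation.ReflTransGen H.Adj u v →
        Relation.ReflTransGen (H.deleteVertices (e \ {r})).Adj (c u) (c v) := by
      intro u v huv
      refine Relation.ReflTransGen.lift' c (fun a b hab ↦ ?_) u v huv
      obtain ⟨f, hf, haf, hbf⟩ := hab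
      change Relation.ReflTransGen _ (c a) (c b)
      by_cases hfe : f = e
      · subst hfe
        simp only [c, haf, hbf, if_true]
        exact .refl
      · have hf' : f ∈ (H.deleteVertices (e \ {r})).edgeSet := by
          rw [h.edgeSet_deleteVertices]
          exact ⟨hf, hfe⟩
        have hsub := Hypergraph.subset_vertexSet_of_mem_edgeSet' _ hf'
        rw [hc a (hsub haf), hc b (hsub hbf)]
        exact .single ⟨f, hf', haf, hbf⟩
    intro u hu v hv
    have := key u v (hH.connected.2 u hu.1 v hv.1)
    rwa [hc u hu, hc v hv] at this
  · rintro ⟨n, v, f, hn, hv, hf, hcyc⟩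
    exact hH.acyclic ⟨n, v, f, hn, hv, hf, fun i ↦ ⟨(hcyc i).1.1, (hcyc i).2⟩⟩

theorem degree_eq_one (h : H.IsPendant e r) {u : α} (hu : u ∈ e) (hur : u ≠ r) :
    H.degree u = 1 := by
  rw [degree, Set.ncard_eq_one]
  refine ⟨e, Set.eq_singleton_iff_unique_mem.2 ⟨⟨h.mem_edgeSet, hu⟩, fun f hf ↦ ?_⟩⟩
  exact h.eq_of_mem u hu hur f hf.1 hf.2

theorem degree_deleteVertices_of_notMem (h : H.IsPendant e r) {v : α} (hv : v ∉ e) :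
    (H.deleteVertices (e \ {r})).degree v = H.degree v := by
  simp only [degree, h.edgeSet_deleteVertices]
  congr 1
  ext f
  simp only [Set.mem_sdiff, Set.mem_singleton_iff, Set.mem_ofPred_eq]
  grind

theorem degree_deleteVertices_self (h : H.IsPendant e r) (hV : H.vertexSet.Finite) :
    (H.deleteVertices (e \ {r})).degree r + 1 = H.degree r := by
  have hfin : {f ∈ H.edgeSet | r ∈ f}.Finite := (finite_edgeSet hV).subset (Set.sep_subset _ _)
  simp only [degree, h.edgeSet_deleteVertices]
  rw [← Set.ncard_sdiff_singleton_add_one (show e ∈ {f ∈ H.edgeSet | r ∈ f} from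
    ⟨h.mem_edgeSet, h.mem⟩) hfin]
  congr 2
  ext f
  simp only [Set.mem_sdiff, Set.mem_singleton_iff, Set.mem_ofPred_eq]
  tauto

end IsPendant

/-- Every hypertree arises from a single vertex by successively attaching pendant edges. -/
theorem IsHypertree.induction {k : ℕ} (hk : 2 ≤ k) {p : Hypergraph α → Prop}
    (single : ∀ H r, H.vertexSet = {r} → H.edgeSet = ∅ → p H)
    (attach : ∀ H e r, H.IsHypertree k → H.vertexSet.Finite → H.IsPendant e r →
      p (H.deleteVertices (e \ {r})) → p H)
    {H : Hypergraph α} (hV : H.vertexSet.Finite) (hH : H.IsHypertree k) : p H := by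
  induction hn : H.edgeSet.ncard generalizing H with
  | zero =>
    have hE : H.edgeSet = ∅ := (Set.ncard_eq_zero (finite_edgeSet hV)).1 hn
    obtain ⟨r, hr⟩ := hH.connected.1
    refine single H r (Set.eq_singleton_iff_unique_mem.2 ⟨hr, fun v hv ↦ ?_⟩) hE
    rcases (hH.connected.2 v hv r hr).cases_head with h | ⟨_, ⟨f, hf, -⟩, -⟩
    · exact h
    · simp [hE] at hf
  | succ n ih =>
    have hE : H.edgeSet.Nonempty := by
      rw [← Set.ncard_pos (finite_edgeSet hV)]
      omega
    obtain ⟨e, r, h⟩ := exists_isPendant hk hV hH.uniform hH.acyclic hE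
    refine attach H e r hH hV h (ih (hV.subset Set.sdiff_subset)
      (h.isHypertree_deleteVertices hH) ?_)
    rw [h.edgeSet_deleteVertices, Set.ncard_sdiff_singleton_of_mem h.mem_edgeSet, hn,
      Nat.add_sub_cancel]

/-! ### Weighted matching sums -/

/-- The matching generating function of `H` with edge weight `s` and vertex weights `w`: the sum
over all matchings `M` of `s ^ |M|` times the product of the weights of the vertices that `M`
leaves uncovered. -/
noncomputable def matchingSum {R : Type*} [CommRing R] (s : R) (H : Hypergraph α) (w : α → R) : R :=
  ∑ᶠ M ∈ H.matchings, s ^ M.ncard * ∏ᶠ v ∈ H.vertexSet \ ⋃₀ M, w v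

theorem finite_matchings {H : Hypergraph α} (hV : H.vertexSet.Finite) : H.matchings.Finite :=
  (finite_edgeSet hV).finite_subsets.subset fun _ hM ↦ hM.1

theorem laplacianMatchingPoly_eq_matchingSum (k : ℕ) (T S : Hypergraph α) :
    laplacianMatchingPoly k T S =
      matchingSum ((-1) ^ (k - 1)) S fun v ↦ X - C (T.degree v : ℂ) := by
  simp only [laplacianMatchingPoly, matchingSum, pow_mul]

theorem map_matchingSum {R R' : Type*} [CommRing R] [CommRing R'] (f : R →+* R') (s : R)
    {H : Hypergraph α} (hV : H.vertexSet.Finite) (w : α → R) :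
    f (matchingSum s H w) = matchingSum (f s) H fun v ↦ f (w v) := by
  refine (f.toAddMonoidHom.map_finsum_mem _ (finite_matchings hV)).trans
    (finsum_mem_congr rfl fun M _ ↦ ?_)
  change f _ = _
  rw [map_mul, map_pow]
  exact congrArg _ (f.toMonoidHom.map_finprod_mem _ hV.sdiff)

theorem matchingSum_of_edgeSet_eq_empty {R : Type*} [CommRing R] (s : R) {H : Hypergraph α} {r : α}
    (hV : H.vertexSet = {r}) (hE : H.edgeSet = ∅) (w : α → R) : matchingSum s H w = w r := by
  have : H.matchings = {∅} := by
    ext M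
    simp only [matchings, hE, Set.subset_empty_iff, Set.mem_ofPred_eq, Set.mem_singleton_iff]
    exact ⟨fun h ↦ h.1, fun h ↦ ⟨h, by simp [h]⟩⟩
  simp [matchingSum, this, hV]

/-- A matching sum is affine in the weight of a vertex. -/
theorem exists_matchingSum_update {R : Type*} [CommRing R] [DecidableEq α] (s : R)
    {H : Hypergraph α} (hV : H.vertexSet.Finite) {r : α} (hr : r ∈ H.vertexSet) (w : α → R) :
    ∃ A : R, ∀ c : R, matchingSum s H (Function.update w r c) =
      A + c * ∑ᶠ M ∈ {M ∈ H.matchings | r ∉ ⋃₀ M},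
        s ^ M.ncard * ∏ᶠ v ∈ (H.vertexSet \ ⋃₀ M) \ {r}, w v := by
  refine ⟨∑ᶠ M ∈ H.matchings \ {M ∈ H.matchings | r ∉ ⋃₀ M},
    s ^ M.ncard * ∏ᶠ v ∈ H.vertexSet \ ⋃₀ M, w v, fun c ↦ ?_⟩
  have hfin := finite_matchings hV
  rw [matchingSum, ← finsum_mem_add_sdiff (Set.sep_subset H.matchings fun M ↦ r ∉ ⋃₀ M) hfin,
    add_comm, mul_finsum_mem' _ _ (hfin.subset (Set.sep_subset _ _))]
  congr 1
  · refine finsum_mem_congr rfl fun M hM ↦ ?_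
    congr 1
    refine finprod_mem_congr rfl fun v hv ↦ Function.update_of_ne ?_ _ _
    rintro rfl
    exact hM.2 ⟨hM.1, hv.2⟩
  · refine finsum_mem_congr rfl fun M hM ↦ ?_
    have hins : H.vertexSet \ ⋃₀ M = insert r ((H.vertexSet \ ⋃₀ M) \ {r}) := by
      rw [Set.insert_sdiff_singleton,
        Set.insert_eq_of_mem (show r ∈ H.vertexSet \ ⋃₀ M from ⟨hr, hM.2⟩)]
    have : ∏ᶠ v ∈ H.vertexSet \ ⋃₀ M, Function.update w r c v =
        c * ∏ᶠ v ∈ (H.vertexSet \ ⋃₀ M) \ {r}, w v := by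
      conv_lhs => rw [hins]
      rw [finprod_mem_insert _ (by simp) hV.sdiff.sdiff, Function.update_self]
      congr 1
      exact finprod_mem_congr rfl fun v hv ↦ Function.update_of_ne hv.2 _ _
    rw [this]
    ring

theorem disjoint_of_subset_deleteVertices {H : Hypergraph α} {U : Set α}
    {M : Set (Set α)}
    (hM : M ⊆ (H.deleteVertices U).edgeSet) : Disjoint (⋃₀ M) U :=
  Set.disjoint_sUnion_left.2 fun _ hf ↦ (hM hf).2

namespace IsPendant

variable {H : Hypergraph α} {e : Set α} {r : α}

theorem notMem_of_subset (h : H.IsPendant e r) {M : Set (Set α)}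
    (hM : M ⊆ (H.deleteVertices (e \ {r})).edgeSet) : e ∉ M := fun he ↦ by
  have := hM he
  rw [h.edgeSet_deleteVertices] at this
  exact this.2 rfl

/-- The matchings of `H` split into those that avoid the pendant edge `e`, which are the matchings
of `H` without `e`, and those that use `e`, which arise by adding `e` to a matching that does not
cover `r`. -/
theorem matchings_eq (h : H.IsPendant e r) :
    H.matchings = (H.deleteVertices (e \ {r})).matchings ∪
      insert e '' {M ∈ (H.deleteVertices (e \ {r})).matchings | r ∉ ⋃₀ M} := by
  ext M
  simp only [Set.mem_union, Set.mem_image]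
  constructor
  · rintro ⟨hM, hd⟩
    have hsub : M \ {e} ⊆ (H.deleteVertices (e \ {r})).edgeSet := by
      rw [h.edgeSet_deleteVertices]
      exact Set.sdiff_subset_sdiff_left hM
    by_cases he : e ∈ M
    · refine .inr ⟨M \ {e}, ⟨⟨hsub, hd.subset Set.sdiff_subset⟩, ?_⟩, ?_⟩
      · rintro ⟨f, hf, hrf⟩
        exact Set.disjoint_left.1 (hd hf.1 he hf.2) hrf h.mem
      · rw [Set.insert_sdiff_singleton, Set.insert_eq_of_mem he]
    · rw [Set.sdiff_singleton_eq_self he] at hsub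
      exact .inl ⟨hsub, hd⟩
  · rintro (⟨hM, hd⟩ | ⟨M, ⟨⟨hM, hd⟩, hr⟩, rfl⟩)
    · exact ⟨hM.trans (Set.sep_subset _ _), hd⟩
    · refine ⟨Set.insert_subset h.mem_edgeSet (hM.trans (Set.sep_subset _ _)),
        hd.insert fun f hf _ ↦ Set.disjoint_left.2 fun u hue huf ↦ ?_⟩
      by_cases hur : u = r
      · subst hur
        exact hr ⟨f, hf, huf⟩
      · exact Set.disjoint_left.1 (hM hf).2 huf ⟨hue, hur⟩

/-- A pendant edge `e` at `r` can be removed from a matching sum, at the price of multiplying by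
the weight `P` of `e \ {r}` and of changing the weight of `r` by `s / P`. -/
theorem matchingSum_eq {R : Type*} [Field R] [DecidableEq α] (h : H.IsPendant e r)
    (hV : H.vertexSet.Finite) (s : R) (w : α → R) (hP : ∏ᶠ v ∈ e \ {r}, w v ≠ 0) :
    matchingSum s H w = (∏ᶠ v ∈ e \ {r}, w v) *
      matchingSum s (H.deleteVertices (e \ {r}))
        (Function.update w r (w r + s / ∏ᶠ v ∈ e \ {r}, w v)) := by
  have heV := H.subset_vertexSet_of_mem_edgeSet' h.mem_edgeSet
  have hefin : (e \ {r}).Finite := (hV.subset heV).sdiff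
  have hV' : (H.deleteVertices (e \ {r})).vertexSet.Finite := hV.sdiff
  have hfin := finite_matchings hV'
  obtain ⟨A, hA⟩ := exists_matchingSum_update s hV' h.mem_vertexSet_deleteVertices w
  have hA₀ := hA (w r)
  rw [Function.update_eq_self] at hA₀
  set B := ∑ᶠ M ∈ {M ∈ (H.deleteVertices (e \ {r})).matchings | r ∉ ⋃₀ M},
    s ^ M.ncard * ∏ᶠ v ∈ ((H.deleteVertices (e \ {r})).vertexSet \ ⋃₀ M) \ {r}, w v with hB
  set P := ∏ᶠ v ∈ e \ {r}, w v with hPdef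
  have key : matchingSum s H w = P * matchingSum s (H.deleteVertices (e \ {r})) w + s * B := by
    rw [matchingSum, h.matchings_eq, finsum_mem_union, finsum_mem_image, matchingSum, hB,
      mul_finsum_mem' _ _ hfin, mul_finsum_mem' _ _ (hfin.subset (Set.sep_subset _ _))]
    · congr 1
      · refine finsum_mem_congr rfl fun M hM ↦ ?_
        have hd := disjoint_of_subset_deleteVertices hM.1
        have hsplit : H.vertexSet \ ⋃₀ M =
            (e \ {r}) ∪ ((H.deleteVertices (e \ {r})).vertexSet \ ⋃₀ M) := by
          rw [Set.disjoint_left] at hd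
          ext v
          simp only [deleteVertices, Set.mem_sdiff, Set.mem_union]
          grind
        rw [hsplit, finprod_mem_union _ hefin hV'.sdiff]
        · ring
        · exact Set.disjoint_left.2 fun v hv hv' ↦ hv'.1.2 hv
      · refine finsum_mem_congr rfl fun M hM ↦ ?_
        have hMfin : M.Finite := (finite_edgeSet hV').subset hM.1.1
        rw [Set.ncard_insert_of_notMem (h.notMem_of_subset hM.1.1) hMfin]
        have hsplit : H.vertexSet \ ⋃₀ (insert e M) =
            ((H.deleteVertices (e \ {r})).vertexSet \ ⋃₀ M) \ {r} := by
          rw [Set.sUnion_insert]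
          ext v
          simp only [deleteVertices, Set.mem_sdiff, Set.mem_union, Set.mem_singleton_iff]
          grind [h.mem]
        rw [hsplit]
        ring
    · intro M hM N hN hMN
      have := congrArg (· \ {e}) hMN
      simpa [Set.insert_sdiff_of_mem, Set.sdiff_singleton_eq_self (h.notMem_of_subset hM.1.1),
        Set.sdiff_singleton_eq_self (h.notMem_of_subset hN.1.1)] using this
    · rw [Set.disjoint_left]
      rintro _ hM ⟨N, -, rfl⟩
      exact h.notMem_of_subset hM.1 (Set.mem_insert _ _)
    · exact hfin
    · exact (hfin.subset (Set.sep_subset _ _)).image _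
  rw [key, hA, hA₀]
  field_simp
  ring

end IsPendant

theorem matchingSum_congr {R : Type*} [CommRing R] (s : R) (H : Hypergraph α) {w w' : α → R}
    (hw : ∀ v ∈ H.vertexSet, w v = w' v) : matchingSum s H w = matchingSum s H w' :=
  finsum_mem_congr rfl fun _ _ ↦ congrArg _ (finprod_mem_congr rfl fun v hv ↦ hw v hv.1)

/-! ### Hypertrees weighted by degrees -/

theorem one_le_finprod_mem {s : Set α} {w : α → ℝ} (hw : ∀ v ∈ s, 1 ≤ w v) :
    1 ≤ ∏ᶠ v ∈ s, w v :=
  finprod_mem_induction (1 ≤ ·) le_rfl (fun _ _ ↦ one_le_mul_of_one_le_of_one_le) hw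

theorem le_finprod_mem {s : Set α} (hs : s.Finite) {w : α → ℝ} (hw : ∀ v ∈ s, 1 ≤ w v) {u : α}
    (hu : u ∈ s) : w u ≤ ∏ᶠ v ∈ s, w v := by
  rw [← Set.insert_eq_of_mem hu, ← Set.insert_sdiff_singleton,
    finprod_mem_insert _ (by simp) hs.sdiff]
  exact le_mul_of_one_le_right (zero_le_one.trans (hw u hu))
    (one_le_finprod_mem fun v hv ↦ hw v hv.1)

/-- The sign `(-1) ^ (k - 1)` of an edge is the sign picked up by the `k - 1` weights `-w v`, so
that removing a pendant edge lowers the weight of its attaching vertex by `1 / ∏ w v`. -/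
theorem IsPendant.matchingSum_neg_eq {k : ℕ} [DecidableEq α] {H : Hypergraph α} {e : Set α} {r : α}
    (h : H.IsPendant e r) (hV : H.vertexSet.Finite) (hu : H.IsUniform k) (w : α → ℝ)
    (hP : ∏ᶠ v ∈ e \ {r}, w v ≠ 0) :
    matchingSum ((-1) ^ (k - 1)) H (fun v ↦ -w v) = (-1) ^ (k - 1) * (∏ᶠ v ∈ e \ {r}, w v) *
      matchingSum ((-1) ^ (k - 1)) (H.deleteVertices (e \ {r}))
        (fun v ↦ -Function.update w r (w r - 1 / ∏ᶠ v ∈ e \ {r}, w v) v) := by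
  have hefin : e.Finite := hV.subset (H.subset_vertexSet_of_mem_edgeSet' h.mem_edgeSet)
  have hcard : (e \ {r}).ncard = k - 1 := by
    rw [Set.ncard_sdiff_singleton_of_mem h.mem, Set.ncard, hu e h.mem_edgeSet, ENat.toNat_natCast]
  have hneg : ∏ᶠ v ∈ e \ {r}, -w v = (-1) ^ (k - 1) * ∏ᶠ v ∈ e \ {r}, w v := by
    rw [finprod_mem_eq_finite_toFinset_prod _ hefin.sdiff,
      finprod_mem_eq_finite_toFinset_prod _ hefin.sdiff, Finset.prod_neg,
      ← Set.ncard_eq_toFinset_card _ hefin.sdiff, hcard]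
  have hs : ((-1 : ℝ) ^ (k - 1)) ≠ 0 := pow_ne_zero _ (by norm_num)
  rw [h.matchingSum_eq hV _ _ (by rw [hneg]; exact mul_ne_zero hs hP), hneg]
  congr 2
  ext v
  by_cases hv : v = r
  · subst hv
    simp only [Function.update_self]
    field_simp
    ring
  · simp [hv]

theorem IsHypertree.matchingSum_degree_eq_zero {k : ℕ} (hk : 2 ≤ k) {H : Hypergraph α}
    (hV : H.vertexSet.Finite) (hH : H.IsHypertree k) :
    matchingSum ((-1) ^ (k - 1)) H (fun v ↦ -(H.degree v : ℝ)) = 0 := by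
  classical
  refine IsHypertree.induction hk (p := fun H ↦
    matchingSum ((-1) ^ (k - 1)) H (fun v ↦ -(H.degree v : ℝ)) = 0) ?_ ?_ hV hH
  · intro H r hV hE
    rw [matchingSum_of_edgeSet_eq_empty _ hV hE]
    simp [degree, hE]
  · intro H e r hH hV h ih
    have hP : ∏ᶠ v ∈ e \ {r}, (H.degree v : ℝ) = 1 :=
      finprod_mem_of_eqOn_one fun v hv ↦ by simp [h.degree_eq_one hv.1 hv.2]
    rw [h.matchingSum_neg_eq hV hH.uniform _ (by rw [hP]; exact one_ne_zero), hP, mul_eq_zero]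
    right
    rw [← ih]
    refine matchingSum_congr _ _ fun v hv ↦ ?_
    by_cases hvr : v = r
    · subst hvr
      simp [← h.degree_deleteVertices_self hV]
    · have hve : v ∉ e := fun hve ↦ hv.2 ⟨hve, hvr⟩
      simp [hvr, h.degree_deleteVertices_of_notMem hve]

/-- If the vertex weights of a hypertree are at least the degrees, then any excess of one of them
over the degree bounds the matching sum from below. -/
theorem IsHypertree.le_abs_matchingSum {k : ℕ} (hk : 2 ≤ k) {H : Hypergraph α}
    (hV : H.vertexSet.Finite) (hH : H.IsHypertree k) {w : α → ℝ} {x : α} {ε : ℝ}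
    (hx : x ∈ H.vertexSet) (hε : 0 ≤ ε) (hw : ∀ v ∈ H.vertexSet, H.degree v ≤ w v)
    (hwx : H.degree x + ε ≤ w x) :
    ε ≤ |matchingSum ((-1) ^ (k - 1)) H fun v ↦ -w v| := by
  classical
  refine IsHypertree.induction hk (p := fun H ↦ ∀ (w : α → ℝ) (x : α) (ε : ℝ),
    x ∈ H.vertexSet → 0 ≤ ε → (∀ v ∈ H.vertexSet, H.degree v ≤ w v) → H.degree x + ε ≤ w x →
    ε ≤ |matchingSum ((-1) ^ (k - 1)) H fun v ↦ -w v|) ?_ ?_ hV hH w x ε hx hε hw hwx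
  · intro H r hV hE w x ε hx hε _ hwx
    rw [hV] at hx
    obtain rfl : x = r := hx
    rw [matchingSum_of_edgeSet_eq_empty _ hV hE, abs_neg]
    simp only [degree, hE, Set.mem_empty_iff_false, false_and, Set.ofPred_false, Set.ncard_empty,
      Nat.cast_zero, zero_add] at hwx
    exact hwx.trans (le_abs_self _)
  · intro H e r hH hV h ih w x ε hx hε hw hwx
    have heV := H.subset_vertexSet_of_mem_edgeSet' h.mem_edgeSet
    have hw1 : ∀ v ∈ e \ {r}, 1 ≤ w v := fun v hv ↦ by
      simpa [h.degree_eq_one hv.1 hv.2] using hw v (heV hv.1)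
    have hP := one_le_finprod_mem hw1
    have hPle : ∀ u ∈ e \ {r}, w u ≤ ∏ᶠ v ∈ e \ {r}, w v := fun u hu ↦
      le_finprod_mem (hV.subset heV).sdiff hw1 hu
    rw [h.matchingSum_neg_eq hV hH.uniform _ (by linarith), abs_mul, abs_mul, abs_neg_one_pow,
      one_mul, abs_of_pos (by linarith)]
    set P := ∏ᶠ v ∈ e \ {r}, w v
    have hP' : 1 / P ≤ 1 := (div_le_one (by linarith)).2 hP
    have hdr : (H.degree r : ℝ) = (H.deleteVertices (e \ {r})).degree r + 1 := by
      exact_mod_cast (h.degree_deleteVertices_self hV).symm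
    have hwr := hw r (heV h.mem)
    have hw' : ∀ v ∈ (H.deleteVertices (e \ {r})).vertexSet,
        (H.deleteVertices (e \ {r})).degree v ≤ Function.update w r (w r - 1 / P) v := by
      intro v hv
      by_cases hvr : v = r
      · subst hvr
        rw [Function.update_self]
        linarith
      · have hve : v ∉ e := fun hve ↦ hv.2 ⟨hve, hvr⟩
        rw [Function.update_of_ne hvr, h.degree_deleteVertices_of_notMem hve]
        exact hw v hv.1
    by_cases hxe : x ∈ e \ {r}
    · -- The excess of `x` makes `P` large, so that the weight of `r` drops by less than one.
      have hxP := hPle x hxe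
      rw [h.degree_eq_one hxe.1 hxe.2, Nat.cast_one] at hwx
      have := ih _ r (1 - 1 / P) h.mem_vertexSet_deleteVertices (by linarith) hw'
        (by rw [Function.update_self]; linarith)
      have hmul := mul_le_mul_of_nonneg_left this (zero_le_one.trans hP)
      have : P * (1 - 1 / P) = P - 1 := by field_simp
      linarith
    · have := ih _ x ε ⟨hx, hxe⟩ hε hw' (by
        by_cases hxr : x = r
        · subst hxr
          rw [Function.update_self]
          linarith
        · have hxe' : x ∉ e := fun hxe' ↦ hxe ⟨hxe', hxr⟩
          rwa [Function.update_of_ne hxr, h.degree_deleteVertices_of_notMem hxe'])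
      exact this.trans (le_mul_of_one_le_left (abs_nonneg _) hP)

/-! ### The Laplacian matching polynomial at zero -/

theorem eval_laplacianMatchingPoly {k : ℕ} (T : Hypergraph α) {S : Hypergraph α}
    (hV : S.vertexSet.Finite) (y : ℝ) :
    (laplacianMatchingPoly k T S).eval (-y : ℂ) =
      (matchingSum ((-1) ^ (k - 1)) S fun v ↦ -(T.degree v + y) : ℝ) := by
  rw [laplacianMatchingPoly_eq_matchingSum, ← coe_evalRingHom, map_matchingSum _ _ hV,
    ← Complex.ofRealHom_eq_coe, ← Complex.ofRealHom_eq_coe, map_matchingSum _ _ hV]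
  simp only [coe_evalRingHom, eval_sub, eval_X, eval_C, map_pow, map_neg, map_one,
    Complex.ofRealHom_eq_coe, Complex.ofReal_add, Complex.ofReal_natCast]
  congr 1
  ext v
  ring

theorem degree_le_of_isSubhypergraph {S T : Hypergraph α} (hST : S.IsSubhypergraph T)
    (hV : T.vertexSet.Finite) (v : α) : S.degree v ≤ T.degree v :=
  Set.ncard_le_ncard (fun _ he ↦ ⟨hST.2 he.1, he.2⟩)
    ((finite_edgeSet hV).subset (Set.sep_subset _ _))

/-- Since `T` is connected, a proper sub-hypergraph misses an edge of `T` at one of its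
vertices. -/
theorem exists_degree_lt {k : ℕ} (hk : 2 ≤ k) {S T : Hypergraph α} (hV : T.vertexSet.Finite)
    (hT : T.IsHypertree k) (hST : S.IsSubhypergraph T) (hS : S.vertexSet.Nonempty) (hne : S ≠ T) :
    ∃ v ∈ S.vertexSet, S.degree v < T.degree v := by
  have hmiss : ∃ v ∈ S.vertexSet, ∃ e ∈ T.edgeSet, v ∈ e ∧ e ∉ S.edgeSet := by
    by_contra! hno
    obtain ⟨x, hx⟩ := hS
    have hVV : T.vertexSet ⊆ S.vertexSet := by
      intro y hy
      induction hT.connected.2 x (hST.1 hx) y hy with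
      | refl => exact hx
      | tail _ hbc ih =>
        obtain ⟨e, he, hb, hc⟩ := hbc
        exact S.subset_vertexSet_of_mem_edgeSet'
          (hno _ (ih (T.subset_vertexSet_of_mem_edgeSet' he hb)) e he hb) hc
    refine hne (Hypergraph.ext (hST.1.antisymm hVV) (hST.2.antisymm fun e he ↦ ?_))
    obtain ⟨v, hv⟩ := (hT.uniform.nontrivial hk he).nonempty
    exact hno v (hVV (T.subset_vertexSet_of_mem_edgeSet' he hv)) e he hv
  obtain ⟨v, hv, e, he, hve, heS⟩ := hmiss
  refine ⟨v, hv, Set.ncard_lt_ncard ⟨fun _ hf ↦ ⟨hST.2 hf.1, hf.2⟩, fun hsub ↦ heS ?_⟩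
    ((finite_edgeSet hV).subset (Set.sep_subset _ _))⟩
  exact (hsub (show e ∈ {f ∈ T.edgeSet | v ∈ f} from ⟨he, hve⟩)).1

end Hypergraph

theorem theorem3p4 {α : Type*} (k : ℕ) (hk : 2 ≤ k) (T : Hypergraph α)
    (hfin : T.vertexSet.Finite) (hT : T.IsHypertree k) :
    (Hypergraph.laplacianMatchingPoly k T T).rootMultiplicity 0 = 1 ∧
    ∀ S : Hypergraph α, S.IsSubhypergraph T → S.IsHypertree k → S ≠ T →
      ¬ (Hypergraph.laplacianMatchingPoly k T S).IsRoot 0 := by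
  constructor
  · obtain ⟨x, hx⟩ := hT.connected.1
    have hle : ∀ y : ℝ, 0 ≤ y → y ≤ ‖(Hypergraph.laplacianMatchingPoly k T T).eval (-y : ℂ)‖ := by
      intro y hy
      rw [Hypergraph.eval_laplacianMatchingPoly T hfin, Complex.norm_real]
      exact hT.le_abs_matchingSum hk hfin hx hy (fun v _ ↦ by linarith) le_rfl
    have h0 : Hypergraph.laplacianMatchingPoly k T T ≠ 0 := by
      intro h
      have := hle 1 zero_le_one
      rw [h] at this
      norm_num at this
    apply le_antisymm
    · -- A double root would make the values at `-y` of order `y ^ 2`.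
      by_contra! hmul
      obtain ⟨q, hq⟩ := (le_rootMultiplicity_iff h0).1 hmul
      have hone : ∀ y : ℝ, 0 < y → 1 ≤ y * ‖q.eval (-y : ℂ)‖ := by
        intro y hy
        have := hle y hy.le
        rw [hq] at this
        simp only [map_zero, sub_zero, eval_mul, eval_pow, eval_X, norm_mul, norm_pow, norm_neg,
          Complex.norm_real, Real.norm_of_nonneg hy.le] at this
        nlinarith
      have hcont : Continuous fun y : ℝ ↦ y * ‖q.eval (-y : ℂ)‖ := by fun_prop
      have hlim := (hcont.tendsto 0).mono_left (nhdsWithin_le_nhds (s := Set.Ioi 0))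
      have := ge_of_tendsto hlim (Filter.eventually_of_mem self_mem_nhdsWithin hone)
      norm_num at this
    · rw [Nat.one_le_iff_ne_zero, ← Nat.pos_iff_ne_zero, rootMultiplicity_pos h0, IsRoot.def]
      have := Hypergraph.eval_laplacianMatchingPoly (k := k) T hfin 0
      simpa [hT.matchingSum_degree_eq_zero hk hfin] using this
  · intro S hST hS hne hroot
    have hSfin := hfin.subset hST.1
    obtain ⟨x, hx, hlt⟩ := Hypergraph.exists_degree_lt hk hfin hT hST hS.connected.1 hne
    have hle := hS.le_abs_matchingSum hk hSfin (w := fun v ↦ T.degree v + (0 : ℝ)) hx zero_le_one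
      (fun v _ ↦ by simpa using Hypergraph.degree_le_of_isSubhypergraph hST hfin v)
      (by rw [add_zero]; exact_mod_cast hlt)
    have := Hypergraph.eval_laplacianMatchingPoly (k := k) T hSfin 0
    rw [Complex.ofReal_zero, neg_zero, hroot.eq_zero] at this
    rw [Complex.ofReal_eq_zero.1 this.symm] at hle
    norm_num at hle
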